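/- Let $\mathbb F\in\{\mathbb R,\mathbb C\}$ and let $(H,e)$ be a computable Hilbert space over $\mathbb F$: $e=(e_n)_{n\in\mathbb N}$ is a sequence with dense linear span in the Hilbert space $H$, and $(m,n)\mapsto\|\alpha_e(m)-\alpha_e(n)\|$ is a computable double sequence of reals, where $\alpha_e$ is the standard enumeration of the finite linear combinations of $e_0,e_1,\dots$ with coefficients in $\mathbb Q$ (respectively $\mathbb Q+i\mathbb Q$). Points of $H$ are represented by their Cauchy names, i.e. sequences $(n_k)$ in $\mathbb N$ with $\alpha_e(n_k)\to x$ and $\|\alpha_e(n_k)-\alpha_e(n_l)\|<2^{-k}$ for $l>k$; reals are represented in the same way through the standard enumeration of $\mathbb Q$. A family of points indexed by $\mathbb N$ or $\mathbb N\times\mathbb N$ is computable if a name of its member can be computed from the index. Let $(H_i)_{i\in\mathbb N}$ be a sequence of Hilbert spaces over $\mathbb F$ with fundamental sequences $u_i=(u_{in})_n$ which are computable Hilbert spaces uniformly in $i$ (the span of each $u_i$ is dense in $H_i$, and $\|\alpha_{u_i}(m)-\alpha_{u_i}(n)\|$ is computable from $i,m,n$). For each $i$ let $(e_{ij})_{j\in\mathbb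 N}$ be an orthonormal basis of $H_i$ such that $(e_{ij})_{i,j}$ is computable, i.e. a Cauchy name of $e_{ij}$ in $H_i$ can be computed from $i$ and $j$. Let $(\Lambda_i)_{i\in\mathbb N}$, with $\Lambda_i:H\to H_i$ bounded and linear, be a computable $g$-frame for $H$ with respect to $(H_i)$. This means that there are constants $0<A\le B<\infty$ with $$A\|f\|^2\le\sum_{i\in\mathbb N}\|\Lambda_i f\|^2\le B\|f\|^2\quad\text{for all } f\in H,$$ and that $(\Lambda_i)$ is a computable sequence: from $i$ one can compute a name of $\Lambda_i$ in the function space representation $[\delta_H\to\delta_{H_i}]$, that is, a description of a realizer transforming each Cauchy name of each $f\in H$ into a Cauchy name of $\Lambda_i f$. Suppose that $(\|\Lambda_i^*e_{ij}\|)_{i,j\in\mathbb N}$ is a computable double sequence of real numbers. Then $(\Lambda_i^*e_{ij})_{i,j\in\mathbb N}$ is a computable frame for $H$: there are constants $A',B'>0$ such that $$A'\|f\|^2\le\sum_{i,j\in\mathbb N}|\langle f,\Lambda_i^*e_{ij}\rangle|^2\le B'\|f\|^2\quad\text{for all } f\in H,$$ and $(\Lambda_i^*e_{ij})_{i,j}$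 is a computable double sequence in $H$, i.e. a Cauchy name of $\Lambda_i^*e_{ij}$ can be computed from $i$ and $j$. -/

import Mathlib

open Filter Topology

namespace CompHilbert

/-! ### Names and realizers

Names are elements of Baire space `ℕ → ℕ`.  A realizer is presented by the monotone word function
that sends a finite initial segment of the input tape to the part of the one-way output tape that
the machine has written by the time it has used that segment. -/

/-- The first `n` symbols of the infinite sequence `p`. -/
def initSeg (p : ℕ → ℕ) (n : ℕ) : List ℕ := (List.range n).map p

/-- On input `p`, the machine with word function `h` writes the infinite sequence `q`: everything
it writes agrees with `q`, and every position of `q` is eventually written. -/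
def Writes (h : List ℕ → List ℕ) (p q : ℕ → ℕ) : Prop :=
  (∀ n, h (initSeg p n) = initSeg q (h (initSeg p n)).length) ∧
    ∀ k, ∃ n, k < (h (initSeg p n)).length

/-- `p` is a name of `x` in the Cauchy representation given by the dense sequence `α`:
`α (p 0), α (p 1), …` converges to `x`, and `d (α (p i), α (p j)) < 2 ^ (-i)` for all `j > i`. -/
def IsCauchyName {X : Type*} [PseudoMetricSpace X] (α : ℕ → X) (p : ℕ → ℕ) (x : X) : Prop :=
  (∀ i j, i < j → dist (α (p i)) (α (p j)) < (1 / 2 : ℝ) ^ i) ∧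
    Tendsto (fun i => α (p i)) atTop (𝓝 x)

/-- `h` is a name of the function `f : X → Y` in the function space representation `[δ_X → δ_Y]`
built from the Cauchy representations `δ_X`, `δ_Y`: it is (the table of) a monotone word function
that transforms every name of every point `x` into a name of `f x`. -/
def IsFunName {X Y : Type*} [PseudoMetricSpace X] [PseudoMetricSpace Y] (α : ℕ → X) (β : ℕ → Y)
    (h : List ℕ → List ℕ) (f : X → Y) : Prop :=
  (∀ u v, u <+: v → h u <+: h v) ∧
    ∀ p x, IsCauchyName α p x → ∃ q, Writes h p q ∧ IsCauchyName β q (f x)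

/-! ### Computable families of points and of functions -/

/-- The family of points `x t ∈ X t`, where `t` runs through a discrete index set such as `ℕ` or
`ℕ × ℕ`, is computable: from `t` one computes (the terms of) a Cauchy name of `x t`. -/
def ComputableFamily {ι : Type*} [Primcodable ι] {X : ι → Type*} [∀ t, PseudoMetricSpace (X t)]
    (α : ∀ t, ℕ → X t) (x : ∀ t, X t) : Prop :=
  ∃ q : ι → ℕ → ℕ, Computable₂ q ∧ ∀ t, IsCauchyName (α t) (q t) (x t)

/-- The sequence of functions `f i : X → Y i` is computable: from `i` one computes a name of `f i`
in the function space representation. -/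
def ComputableFunSeq {X : Type*} [PseudoMetricSpace X] {Y : ℕ → Type*}
    [∀ i, PseudoMetricSpace (Y i)] (α : ℕ → X) (β : ∀ i, ℕ → Y i) (f : ∀ i, X → Y i) : Prop :=
  ∃ h : ℕ → List ℕ → List ℕ, Computable₂ h ∧ ∀ i, IsFunName α (β i) (h i) (f i)

/-! ### Scalars -/

/-- The standard numbering `⟨i, j, k⟩ ↦ (i - j) / (k + 1)` of the rational numbers in `ℝ`. -/
noncomputable def ratReal (n : ℕ) : ℝ :=
  ((n.unpair.1 : ℝ) - (n.unpair.2.unpair.1 : ℝ)) / ((n.unpair.2.unpair.2 : ℝ) + 1)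

/-- The standard numbering of the dense set of rational scalars in `𝕜`: of `ℚ + ℚ I` if `𝕜 = ℂ`,
and of `ℚ` if `𝕜 = ℝ` (where `I = 0`). -/
noncomputable def ratScalar (𝕜 : Type*) [RCLike 𝕜] (n : ℕ) : 𝕜 :=
  (ratReal n.unpair.1 : 𝕜) + (ratReal n.unpair.2 : 𝕜) * RCLike.I

/-- A family of real numbers is computable (with respect to the Cauchy representation of `ℝ`). -/
def ComputableReals {ι : Type*} [Primcodable ι] (x : ι → ℝ) : Prop :=
  ComputableFamily (fun _ => ratReal) x

/-! ### Computable metric spaces and computable Hilbert spaces -/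

/-- The metric spaces `X i` with the sequences `α i` are computable metric spaces, uniformly in
the index `i`: each `α i` is dense, and `d (α i m, α i n)` is computable from `i, m, n`. -/
def IsComputableMetricFamily {ι : Type*} [Primcodable ι] {X : ι → Type*}
    [∀ i, PseudoMetricSpace (X i)] (α : ∀ i, ℕ → X i) : Prop :=
  (∀ i, DenseRange (α i)) ∧
    ComputableReals (fun t : ι × ℕ × ℕ => dist (α t.1 t.2.1) (α t.1 t.2.2))

section Hilbert

variable (𝕜 : Type*) [RCLike 𝕜]

/-- The sequence `α_e` of all rational linear combinations of `e 0, e 1, …`: the number that codes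
the list `[n₀, …, n_k]` is sent to the sum of `ratScalar 𝕜 nᵢ • e i` over `i ≤ k`. -/
noncomputable def ratComb {H : Type*} [NormedAddCommGroup H] [InnerProductSpace 𝕜 H]
    (e : ℕ → H) (n : ℕ) : H :=
  ∑ i : Fin (Denumerable.ofNat (List ℕ) n).length,
    ratScalar 𝕜 ((Denumerable.ofNat (List ℕ) n).get i) • e i

/-- The Hilbert spaces `H i` with the fundamental sequences `e i` are computable Hilbert spaces,
uniformly in the index `i`. -/
def IsComputableHilbertFamily {ι : Type*} [Primcodable ι] {H : ι → Type*}
    [∀ i, NormedAddCommGroup (H i)] [∀ i, InnerProductSpace 𝕜 (H i)] (e : ∀ i, ℕ → H i) : Prop :=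
  (∀ i, Dense (Submodule.span 𝕜 (Set.range (e i)) : Set (H i))) ∧
    IsComputableMetricFamily (fun i => ratComb 𝕜 (e i))

/-- The Hilbert space `H` with the fundamental sequence `e` is a computable Hilbert space. -/
def IsComputableHilbertSpace {H : Type*} [NormedAddCommGroup H] [InnerProductSpace 𝕜 H]
    (e : ℕ → H) : Prop :=
  IsComputableHilbertFamily 𝕜 (fun _ : Unit => e)

/-! ### Frames and g-frames -/

/-- `f` is a frame for `H`. -/
def IsFrame {ι : Type*} {H : Type*} [NormedAddCommGroup H] [InnerProductSpace 𝕜 H]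
    (f : ι → H) : Prop :=
  ∃ A B : ℝ, 0 < A ∧ 0 < B ∧ ∀ x : H, Summable (fun t => ‖inner 𝕜 (f t) x‖ ^ 2) ∧
    A * ‖x‖ ^ 2 ≤ ∑' t, ‖inner 𝕜 (f t) x‖ ^ 2 ∧ ∑' t, ‖inner 𝕜 (f t) x‖ ^ 2 ≤ B * ‖x‖ ^ 2

/-- `f` is a computable frame for `H` with fundamental sequence `e`: a frame that is a computable
family of points of `H`. -/
def IsComputableFrame {ι : Type*} [Primcodable ι] {H : Type*} [NormedAddCommGroup H]
    [InnerProductSpace 𝕜 H] (e : ℕ → H) (f : ι → H) : Prop :=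
  IsFrame 𝕜 f ∧ ComputableFamily (fun _ => ratComb 𝕜 e) f

variable {𝕜}

/-- `Λ` is a g-frame for `H` with respect to the spaces `K i`. -/
def IsGFrame {H : Type*} [NormedAddCommGroup H] [InnerProductSpace 𝕜 H] {K : ℕ → Type*}
    [∀ i, NormedAddCommGroup (K i)] [∀ i, InnerProductSpace 𝕜 (K i)]
    (Λ : ∀ i, H →L[𝕜] K i) : Prop :=
  ∃ A B : ℝ, 0 < A ∧ A ≤ B ∧ ∀ x : H, Summable (fun i => ‖Λ i x‖ ^ 2) ∧
    A * ‖x‖ ^ 2 ≤ ∑' i, ‖Λ i x‖ ^ 2 ∧ ∑' i, ‖Λ i x‖ ^ 2 ≤ B * ‖x‖ ^ 2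

/-- `Λ` is a computable g-frame for `H` with respect to the spaces `K i`, where `e` and `u i` are
the fundamental sequences of `H` and `K i`. -/
def IsComputableGFrame {H : Type*} [NormedAddCommGroup H] [InnerProductSpace 𝕜 H] {K : ℕ → Type*}
    [∀ i, NormedAddCommGroup (K i)] [∀ i, InnerProductSpace 𝕜 (K i)] (e : ℕ → H)
    (u : ∀ i, ℕ → K i) (Λ : ∀ i, H →L[𝕜] K i) : Prop :=
  IsGFrame Λ ∧
    ComputableFunSeq (ratComb 𝕜 e) (fun i => ratComb 𝕜 (u i)) (fun i x => Λ i x)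

end Hilbert

end CompHilbert

/-!
Write `x = Λ i† (b i j)`. Both halves of the claim come from moving the adjoint to the other side of
the inner product.

The family is a frame because `⟪Λ i† (b i j), f⟫ = ⟪b i j, Λ i f⟫`, so that Parseval's identity in
each `K i` turns the frame sum of `f` into `∑ i, ‖Λ i f‖ ^ 2`, with the same constants
(`IsGFrame.isFrame_adjoint`).

For computability, let `α n` be the `n`-th rational combination of `e`. As `‖b i j‖ = 1`, expanding
two squares gives (`sq_dist_adjoint`)
`‖α n - x‖ ^ 2 = ‖α n‖ ^ 2 + ‖x‖ ^ 2 + ‖Λ i (α n) - b i j‖ ^ 2 - ‖Λ i (α n)‖ ^ 2 - 1`.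
Each norm on the right is a computable real: `‖x‖` by hypothesis, and the others as distances of
computable points of computable metric spaces (`IsComputableMetricFamily.dist`), where `Λ i (α n)` is
computed by running the realizer on the constant name of `α n` (`ComputableFunSeq.eval`). Hence
`‖α n - x‖ < 2 ^ (-k)` is semidecidable (`ComputableReals.exists_semidecision`). By density there is
always such an `n`, so an unbounded search finds one, and these `n` form a Cauchy name of `x`.
-/

namespace CompHilbert

/-! ### Cauchy names -/

section CauchyName

variable {X : Type*} [PseudoMetricSpace X] {α : ℕ → X} {p : ℕ → ℕ} {x : X}

theorem IsCauchyName.dist_le (h : IsCauchyName α p x) (k : ℕ) :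
    dist (α (p k)) x ≤ (1 / 2 : ℝ) ^ k := by
  have h2 : Tendsto (fun j => dist (α (p k)) (α (p j))) atTop (𝓝 (dist (α (p k)) x)) :=
    tendsto_const_nhds.dist h.2
  refine le_of_tendsto h2 ?_
  filter_upwards [eventually_gt_atTop k] with j hj
  exact (h.1 k j hj).le

/-- A sequence converging with errors at most `2 ^ (-k-1)` is a Cauchy name: the strict inequality
between its terms holds since the later of the two errors is strictly smaller. -/
theorem IsCauchyName.of_dist_le (h : ∀ k, dist (α (p k)) x ≤ (1 / 2 : ℝ) ^ (k + 1)) :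
    IsCauchyName α p x := by
  constructor
  · intro i j hij
    have h1 : (1 / 2 : ℝ) ^ (j + 1) < (1 / 2 : ℝ) ^ (i + 1) :=
      pow_lt_pow_right_of_lt_one₀ (by norm_num) (by norm_num) (by omega)
    have h2 : (1 / 2 : ℝ) ^ i = (1 / 2 : ℝ) ^ (i + 1) + (1 / 2 : ℝ) ^ (i + 1) := by ring
    linarith [dist_triangle_right (α (p i)) (α (p j)) x, h i, h j]
  · rw [tendsto_iff_dist_tendsto_zero]
    refine squeeze_zero (fun _ => dist_nonneg) h ?_
    exact (tendsto_pow_atTop_nhds_zero_of_lt_one (by norm_num) (by norm_num)).comp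
      (tendsto_add_atTop_nat 1)

theorem isCauchyName_const (α : ℕ → X) (n : ℕ) : IsCauchyName α (fun _ => n) (α n) :=
  IsCauchyName.of_dist_le fun k => by simp

end CauchyName

/-! ### Computable families -/

/-- Unbounded search for a witness of a decidable relation that is known to have one. -/
theorem exists_computable_search {σ : Type*} [Primcodable σ] {g : σ → ℕ → Bool}
    (hg : Computable₂ g) (h : ∀ s, ∃ n, g s n = true) :
    ∃ f : σ → ℕ, Computable f ∧ ∀ s, g s (f s) = true := by
  have hp : Partrec fun s => Nat.rfind fun n => Part.some (g s n) :=
    Partrec.rfind (p := fun s n => Part.some (g s n)) hg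
  have hdom : ∀ s, (Nat.rfind fun n => Part.some (g s n)).Dom := fun s => by
    obtain ⟨n, hn⟩ := h s
    obtain ⟨m, hm, -⟩ := Nat.rfind_min' (p := g s) hn
    exact Part.dom_iff_mem.2 ⟨m, hm⟩
  refine ⟨fun s => (Nat.rfind fun n => Part.some (g s n)).get (hdom s), ?_, fun s => ?_⟩
  · exact Partrec.of_eq hp fun s => (Part.some_get (hdom s)).symm
  · have := Nat.rfind_spec (Part.get_mem (hdom s))
    simpa using this

theorem ComputableFamily.comp {ι κ : Type*} [Primcodable ι] [Primcodable κ] {X : ι → Type*}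
    [∀ t, PseudoMetricSpace (X t)] {α : ∀ t, ℕ → X t} {x : ∀ t, X t}
    (h : ComputableFamily α x) {φ : κ → ι} (hφ : Computable φ) :
    ComputableFamily (fun s => α (φ s)) (fun s => x (φ s)) := by
  obtain ⟨q, hq, hx⟩ := h
  exact ⟨fun s => q (φ s), hq.comp (hφ.comp .fst) .snd, fun s => hx (φ s)⟩

/-- Points of the enumerated dense sets are computable from their numbers. -/
theorem computableFamily_enum {ι : Type*} [Primcodable ι] {X : ι → Type*}
    [∀ t, PseudoMetricSpace (X t)] (α : ∀ t, ℕ → X t) {φ : ι → ℕ} (hφ : Computable φ) :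
    ComputableFamily α (fun t => α t (φ t)) :=
  ⟨fun t _ => φ t, (hφ.comp .fst : Computable fun p : ι × ℕ => φ p.1).to₂,
    fun t => isCauchyName_const (α t) (φ t)⟩

theorem initSeg_getElem? (p : ℕ → ℕ) {n k : ℕ} (h : k < n) : (initSeg p n)[k]? = some (p k) := by
  simp [initSeg, h]

/-- A computable sequence of functions can be evaluated on the enumerated dense set: the realizer
is run on the constant name of the point, until it has written the required symbol. -/
theorem ComputableFunSeq.eval {X : Type*} [PseudoMetricSpace X] {Y : ℕ → Type*}
    [∀ i, PseudoMetricSpace (Y i)] {α : ℕ → X} {β : ∀ i, ℕ → Y i} {f : ∀ i, X → Y i}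
    (hf : ComputableFunSeq α β f) :
    ComputableFamily (fun t : ℕ × ℕ => β t.1) (fun t => f t.1 (α t.2)) := by
  obtain ⟨h, hh, hname⟩ := hf
  have hex : ∀ t : ℕ × ℕ, ∃ q, Writes (h t.1) (fun _ => t.2) q ∧
      IsCauchyName (β t.1) q (f t.1 (α t.2)) :=
    fun t => (hname t.1).2 _ _ (isCauchyName_const α t.2)
  choose q hq hqn using hex
  have hseg : Primrec₂ fun n m : ℕ => initSeg (fun _ => n) m :=
    Primrec.list_map (Primrec.list_range.comp Primrec.snd)
      ((Primrec.fst.comp Primrec.fst : Primrec fun a : (ℕ × ℕ) × ℕ => a.1.1).to₂)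
  have hout : Computable₂ fun (s : (ℕ × ℕ) × ℕ) (m : ℕ) => h s.1.1 (initSeg (fun _ => s.1.2) m) :=
    hh.comp (Computable.fst.comp (Computable.fst.comp .fst))
      (hseg.to_comp.comp (Computable.snd.comp (Computable.fst.comp .fst)) .snd)
  have hget : Computable₂ fun (s : (ℕ × ℕ) × ℕ) (m : ℕ) =>
      (h s.1.1 (initSeg (fun _ => s.1.2) m))[s.2]? :=
    Computable.list_getElem?.comp hout (Computable.snd.comp .fst)
  obtain ⟨m, hm, hm'⟩ := exists_computable_search
    (g := fun (s : (ℕ × ℕ) × ℕ) m => decide (s.2 < (h s.1.1 (initSeg (fun _ => s.1.2) m)).length))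
    (Primrec.nat_lt.decide.to_comp.comp (Computable.snd.comp .fst)
      (Computable.list_length.comp hout))
    (fun s => by simpa using (hq s.1).2 s.2)
  refine ⟨fun t k => ((h t.1 (initSeg (fun _ => t.2) (m (t, k))))[k]?).getD 0, ?_, fun t => ?_⟩
  · exact Computable.option_getD (hget.comp .id hm) (.const 0)
  · convert hqn t using 1
    funext k
    have hlt : k < (h t.1 (initSeg (fun _ => t.2) (m (t, k)))).length := by
      simpa using hm' (t, k)
    beta_reduce
    rw [(hq t).1 (m (t, k)), initSeg_getElem? _ hlt]
    rfl

/-- In a uniform family of computable metric spaces, the distance of two computable points is a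
computable real. -/
theorem IsComputableMetricFamily.dist {ι κ : Type*} [Primcodable ι] [Primcodable κ]
    {X : ι → Type*} [∀ i, PseudoMetricSpace (X i)] {α : ∀ i, ℕ → X i}
    (h : IsComputableMetricFamily α) {φ : κ → ι} (hφ : Computable φ) {x y : ∀ s, X (φ s)}
    (hx : ComputableFamily (fun s => α (φ s)) x) (hy : ComputableFamily (fun s => α (φ s)) y) :
    ComputableReals fun s => dist (x s) (y s) := by
  obtain ⟨d, hd, hdn⟩ := h.2
  obtain ⟨p, hp, hpn⟩ := hx
  obtain ⟨q, hq, hqn⟩ := hy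
  have h3 : Computable fun s : κ × ℕ => s.2 + 3 :=
    Primrec.nat_add.to_comp.comp .snd (.const 3)
  refine ⟨fun s k => d (φ s, p s (k + 3), q s (k + 3)) (k + 3), ?_, fun s => ?_⟩
  · exact hd.comp ((hφ.comp .fst).pair ((hp.comp .fst h3).pair (hq.comp .fst h3))) h3
  · refine IsCauchyName.of_dist_le fun k => ?_
    have h1 := (hdn (φ s, p s (k + 3), q s (k + 3))).dist_le (k + 3)
    have h2 := (hpn s).dist_le (k + 3)
    have h3 := (hqn s).dist_le (k + 3)
    have h4 := dist_dist_dist_le (α (φ s) (p s (k + 3))) (α (φ s) (q s (k + 3))) (x s) (y s)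
    have h5 := dist_triangle (ratReal (d (φ s, p s (k + 3), q s (k + 3)) (k + 3)))
      (Dist.dist (α (φ s) (p s (k + 3))) (α (φ s) (q s (k + 3)))) (Dist.dist (x s) (y s))
    have h6 : (1 / 2 : ℝ) ^ (k + 1) = 4 * (1 / 2 : ℝ) ^ (k + 3) := by ring
    have h7 : (0 : ℝ) < (1 / 2 : ℝ) ^ (k + 3) := by positivity
    simp only at h1
    linarith

/-! ### Bounds for computable reals -/

theorem computable_two_pow {σ : Type*} [Primcodable σ] {f : σ → ℕ} (hf : Computable f) :
    Computable fun s => 2 ^ f s :=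
  (Primrec₂.unpaired'.1 Nat.Primrec.pow).to_comp.comp (.const 2) hf

/-- Rounding a rational in `ratReal` coding to an integer multiple of `2 ^ (-m)` is computable. The
truncated subtraction replaces negative rationals by `0`. -/
def ratFloor (n m : ℕ) : ℕ :=
  (n.unpair.1 - n.unpair.2.unpair.1) * 2 ^ m / (n.unpair.2.unpair.2 + 1)

theorem computable_ratFloor : Computable₂ ratFloor := by
  have h1 : Computable fun s : ℕ × ℕ => s.1.unpair := Computable.unpair.comp .fst
  have h2 : Computable fun s : ℕ × ℕ => s.1.unpair.2.unpair :=
    Computable.unpair.comp (Computable.snd.comp h1)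
  exact Primrec.nat_div.to_comp.comp
    (Primrec.nat_mul.to_comp.comp
      (Primrec.nat_sub.to_comp.comp (Computable.fst.comp h1) (Computable.fst.comp h2))
      (computable_two_pow .snd))
    (Primrec.nat_add.to_comp.comp (Computable.snd.comp h2) (.const 1))

theorem ratFloor_spec (n m : ℕ) :
    (ratFloor n m : ℝ) ≤ max (ratReal n) 0 * 2 ^ m ∧
      max (ratReal n) 0 * 2 ^ m < ratFloor n m + 1 := by
  have hD : (0 : ℝ) < (n.unpair.2.unpair.2 : ℝ) + 1 := by positivity
  have hmax : max (ratReal n) 0 =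
      ((n.unpair.1 - n.unpair.2.unpair.1 : ℕ) : ℝ) / ((n.unpair.2.unpair.2 : ℝ) + 1) := by
    rw [ratReal]
    rcases le_total n.unpair.2.unpair.1 n.unpair.1 with h | h
    · have h' : (n.unpair.2.unpair.1 : ℝ) ≤ n.unpair.1 := by exact_mod_cast h
      rw [Nat.cast_sub h, max_eq_left (div_nonneg (by linarith) hD.le)]
    · have h' : (n.unpair.1 : ℝ) ≤ n.unpair.2.unpair.1 := by exact_mod_cast h
      rw [Nat.sub_eq_zero_of_le h, max_eq_right (div_nonpos_of_nonpos_of_nonneg (by linarith) hD.le)]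
      simp
  have hx : max (ratReal n) 0 * 2 ^ m =
      (((n.unpair.1 - n.unpair.2.unpair.1) * 2 ^ m : ℕ) : ℝ) /
        ((n.unpair.2.unpair.2 + 1 : ℕ) : ℝ) := by
    rw [hmax]; push_cast; ring
  rw [hx, ratFloor, ← Nat.floor_div_eq_div (K := ℝ)]
  exact ⟨Nat.floor_le (by positivity), Nat.lt_floor_add_one _⟩

/-- Lower and upper approximations of a nonnegative computable real by multiples of `2 ^ (-m)`. -/
theorem ComputableReals.exists_bounds {ι : Type*} [Primcodable ι] {x : ι → ℝ}
    (hx : ComputableReals x) (h0 : ∀ t, 0 ≤ x t) :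
    ∃ L U : ι → ℕ → ℕ, Computable₂ L ∧ Computable₂ U ∧
      (∀ t m, (L t m : ℝ) ≤ x t * 2 ^ m ∧ x t * 2 ^ m ≤ U t m) ∧
      (∀ t, Tendsto (fun m => (L t m : ℝ) / 2 ^ m) atTop (𝓝 (x t))) ∧
      ∀ t, Tendsto (fun m => (U t m : ℝ) / 2 ^ m) atTop (𝓝 (x t)) := by
  obtain ⟨q, hq, hqn⟩ := hx
  have hN : Computable₂ fun t m => ratFloor (q t m) m := computable_ratFloor.comp hq .snd
  have hb : ∀ t m, (ratFloor (q t m) m : ℝ) - 1 ≤ x t * 2 ^ m ∧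
      x t * 2 ^ m ≤ ratFloor (q t m) m + 2 := by
    intro t m
    have h1 := (hqn t).dist_le m
    rw [Real.dist_eq] at h1
    have h2 : |max (ratReal (q t m)) 0 - x t| ≤ (1 / 2 : ℝ) ^ m := by
      have := abs_max_sub_max_le_abs (ratReal (q t m)) (x t) 0
      rw [max_eq_left (h0 t)] at this
      exact this.trans h1
    have h3 : |max (ratReal (q t m)) 0 * 2 ^ m - x t * 2 ^ m| ≤ 1 := by
      rw [← sub_mul, abs_mul, abs_of_pos (by positivity : (0 : ℝ) < 2 ^ m)]
      calc _ ≤ (1 / 2 : ℝ) ^ m * 2 ^ m := by gcongr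
        _ = 1 := by rw [← mul_pow]; norm_num
    obtain ⟨h4, h5⟩ := ratFloor_spec (q t m) m
    obtain ⟨h6, h7⟩ := abs_le.1 h3
    constructor <;> linarith
  have hlim : ∀ (t : ι) (N : ℕ → ℕ), (∀ m, |(N m : ℝ) - x t * 2 ^ m| ≤ 3) →
      Tendsto (fun m => (N m : ℝ) / 2 ^ m) atTop (𝓝 (x t)) := by
    intro t N h
    rw [tendsto_iff_dist_tendsto_zero]
    have h3 : Tendsto (fun m => 3 * (1 / 2 : ℝ) ^ m) atTop (𝓝 0) := by
      simpa using (tendsto_pow_atTop_nhds_zero_of_lt_one (r := (1 / 2 : ℝ)) (by norm_num)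
        (by norm_num)).const_mul 3
    refine squeeze_zero (fun _ => dist_nonneg) (fun m => ?_) h3
    have h2 : (0 : ℝ) < 2 ^ m := by positivity
    have e : (N m : ℝ) / 2 ^ m - x t = ((N m : ℝ) - x t * 2 ^ m) / 2 ^ m := by field_simp
    rw [Real.dist_eq, e, abs_div, abs_of_pos h2, one_div_pow, mul_one_div]
    gcongr
    exact h m
  have hL : ∀ t m, ((ratFloor (q t m) m - 1 : ℕ) : ℝ) ≤ x t * 2 ^ m := by
    intro t m
    rcases Nat.eq_zero_or_pos (ratFloor (q t m) m) with h | h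
    · rw [h]; simpa using mul_nonneg (h0 t) (by positivity : (0 : ℝ) ≤ 2 ^ m)
    · rw [Nat.cast_sub h]; simpa using (hb t m).1
  have hL' : ∀ t m, (ratFloor (q t m) m : ℝ) - 1 ≤ ((ratFloor (q t m) m - 1 : ℕ) : ℝ) := by
    intro t m
    have : ratFloor (q t m) m ≤ (ratFloor (q t m) m - 1) + 1 := by omega
    have : (ratFloor (q t m) m : ℝ) ≤ ((ratFloor (q t m) m - 1 : ℕ) : ℝ) + 1 := by
      exact_mod_cast this
    linarith
  refine ⟨fun t m => ratFloor (q t m) m - 1, fun t m => ratFloor (q t m) m + 2,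
    Primrec.nat_sub.to_comp.comp hN (.const 1), Primrec.nat_add.to_comp.comp hN (.const 2),
    fun t m => ⟨hL t m, ?_⟩, fun t => hlim t _ fun m => ?_, fun t => hlim t _ fun m => ?_⟩
  · push_cast; exact (hb t m).2
  · rw [abs_le]
    constructor <;> linarith [hL t m, hL' t m, (hb t m).2]
  · push_cast
    rw [abs_le]
    constructor <;> linarith [(hb t m).1, (hb t m).2]

/-- For nonnegative computable reals, the strict inequality `a² + b² + c² < d² + 1 + 4 ^ (-k)` is
semidecidable: it holds if and only if it is confirmed by rational bounds at some precision
`2 ^ (-m)`. -/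
theorem ComputableReals.exists_semidecision {ι : Type*} [Primcodable ι] {a b c d : ι → ℝ}
    (ha : ComputableReals a) (hb : ComputableReals b) (hc : ComputableReals c)
    (hd : ComputableReals d) (ha0 : ∀ t, 0 ≤ a t) (hb0 : ∀ t, 0 ≤ b t) (hc0 : ∀ t, 0 ≤ c t)
    (hd0 : ∀ t, 0 ≤ d t) :
    ∃ g : ι × ℕ → ℕ → Bool, Computable₂ g ∧ ∀ t k, (∃ m, g (t, k) m = true) ↔
      a t ^ 2 + b t ^ 2 + c t ^ 2 < d t ^ 2 + 1 + (1 / 4 : ℝ) ^ k := by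
  obtain ⟨_, A, -, hA, hA1, -, hA2⟩ := ha.exists_bounds ha0
  obtain ⟨_, B, -, hB, hB1, -, hB2⟩ := hb.exists_bounds hb0
  obtain ⟨_, C, -, hC, hC1, -, hC2⟩ := hc.exists_bounds hc0
  obtain ⟨D, _, hD, -, hD1, hD2, -⟩ := hd.exists_bounds hd0
  -- The inequality at precision `2 ^ (-m)`, multiplied by `4 ^ (k + m)` to clear denominators.
  have key : ∀ t k m, ((2 ^ k * 2 ^ k) * ((A t m * A t m + B t m * B t m) + C t m * C t m) <
      (2 ^ k * 2 ^ k) * (D t m * D t m + 2 ^ m * 2 ^ m) + 2 ^ m * 2 ^ m) ↔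
      ((A t m : ℝ) / 2 ^ m) ^ 2 + ((B t m : ℝ) / 2 ^ m) ^ 2 + ((C t m : ℝ) / 2 ^ m) ^ 2 <
        ((D t m : ℝ) / 2 ^ m) ^ 2 + 1 + (1 / 4 : ℝ) ^ k := by
    intro t k m
    have h4 : (1 / 4 : ℝ) ^ k = 1 / (2 ^ k * 2 ^ k) := by
      rw [← mul_pow, one_div_pow]; norm_num
    have hk : (0 : ℝ) < (2 ^ k * 2 ^ k) * (2 ^ m * 2 ^ m) := by positivity
    rw [h4, ← mul_lt_mul_iff_right₀ hk, ← Nat.cast_lt (α := ℝ)]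
    push_cast
    have e1 : (2 ^ k * 2 ^ k) * (2 ^ m * 2 ^ m) * (((A t m : ℝ) / 2 ^ m) ^ 2 +
        ((B t m : ℝ) / 2 ^ m) ^ 2 + ((C t m : ℝ) / 2 ^ m) ^ 2) =
        (2 ^ k * 2 ^ k) * ((A t m * A t m + B t m * B t m) + C t m * C t m) := by
      field_simp
    have e2 : (2 ^ k * 2 ^ k) * (2 ^ m * 2 ^ m) * (((D t m : ℝ) / 2 ^ m) ^ 2 + 1 +
        1 / (2 ^ k * 2 ^ k)) =
        (2 ^ k * 2 ^ k) * (D t m * D t m + 2 ^ m * 2 ^ m) + 2 ^ m * 2 ^ m := by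
      field_simp
    rw [e1, e2]
  refine ⟨fun s m => decide
    ((2 ^ s.2 * 2 ^ s.2) * ((A s.1 m * A s.1 m + B s.1 m * B s.1 m) + C s.1 m * C s.1 m) <
      (2 ^ s.2 * 2 ^ s.2) * (D s.1 m * D s.1 m + 2 ^ m * 2 ^ m) + 2 ^ m * 2 ^ m), ?_, ?_⟩
  · have hsq : ∀ {f : (ι × ℕ) × ℕ → ℕ}, Computable f → Computable fun s => f s * f s :=
      fun hf => Primrec.nat_mul.to_comp.comp hf hf
    have happ : ∀ {F : ι → ℕ → ℕ}, Computable₂ F →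
        Computable fun s : (ι × ℕ) × ℕ => F s.1.1 s.2 * F s.1.1 s.2 :=
      fun hF => hsq (hF.comp (Computable.fst.comp .fst) .snd)
    have hk : Computable fun s : (ι × ℕ) × ℕ => 2 ^ s.1.2 * 2 ^ s.1.2 :=
      hsq (computable_two_pow (Computable.snd.comp .fst))
    have hm : Computable fun s : (ι × ℕ) × ℕ => 2 ^ s.2 * 2 ^ s.2 :=
      hsq (computable_two_pow .snd)
    have hadd := Primrec.nat_add.to_comp
    have hmul := Primrec.nat_mul.to_comp
    exact Primrec.nat_lt.decide.to_comp.comp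
      (hmul.comp hk (hadd.comp (hadd.comp (happ hA) (happ hB)) (happ hC)))
      (hadd.comp (hmul.comp hk (hadd.comp (happ hD) hm)) hm)
  · intro t k
    simp only [decide_eq_true_eq, key]
    constructor
    · rintro ⟨m, hm⟩
      have h2 : (0 : ℝ) < 2 ^ m := by positivity
      have hAx := (le_div_iff₀ h2).2 (hA1 t m).2
      have hBx := (le_div_iff₀ h2).2 (hB1 t m).2
      have hCx := (le_div_iff₀ h2).2 (hC1 t m).2
      have hDx := (div_le_iff₀ h2).2 (hD1 t m).1
      have h1 := pow_le_pow_left₀ (ha0 t) hAx 2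
      have h2 := pow_le_pow_left₀ (hb0 t) hBx 2
      have h3 := pow_le_pow_left₀ (hc0 t) hCx 2
      have h4 := pow_le_pow_left₀ (by positivity) hDx 2
      linarith
    · intro h
      exact ((((hA2 t).pow 2).add ((hB2 t).pow 2)).add ((hC2 t).pow 2)).eventually_lt
        ((((hD2 t).pow 2).add_const 1).add_const _) h |>.exists

/-! ### Adjoints and Parseval's identity -/

section Hilbert

variable {𝕜 : Type*} [RCLike 𝕜]

/-- The code of the empty list is a number of `0`, the same one in all spaces. -/
theorem exists_ratComb_eq_zero : ∃ n : ℕ, ∀ {H : Type*} [NormedAddCommGroup H]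
    [InnerProductSpace 𝕜 H] (e : ℕ → H), ratComb 𝕜 e n = 0 := by
  refine ⟨Encodable.encode ([] : List ℕ), fun e => ?_⟩
  have h : (Denumerable.ofNat (List ℕ) (Encodable.encode ([] : List ℕ))).length = 0 := by
    rw [Denumerable.ofNat_encode]; rfl
  have : IsEmpty (Fin (Denumerable.ofNat (List ℕ) (Encodable.encode ([] : List ℕ))).length) := by
    rw [h]; infer_instance
  rw [ratComb, Finset.univ_eq_empty, Finset.sum_empty]

/-- Parseval's identity. -/
theorem hasSum_sq_norm_inner {ι E : Type*} [NormedAddCommGroup E] [InnerProductSpace 𝕜 E]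
    (b : HilbertBasis ι 𝕜 E) (x : E) :
    HasSum (fun i => ‖inner 𝕜 (b i) x‖ ^ 2) (‖x‖ ^ 2) := by
  have h := (RCLike.reCLM (K := 𝕜)).hasSum (b.hasSum_inner_mul_inner x x)
  rw [RCLike.reCLM_apply, inner_self_eq_norm_sq] at h
  have hterm : ∀ i, RCLike.re (inner 𝕜 x (b i) * inner 𝕜 (b i) x) =
      ‖inner 𝕜 (b i) x‖ ^ 2 := fun i => by
    rw [inner_mul_symm_re_eq_norm, norm_mul, norm_inner_symm x (b i), sq]
  simpa only [RCLike.reCLM_apply, hterm] using h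

theorem IsGFrame.isFrame_adjoint {H : Type*} [NormedAddCommGroup H] [InnerProductSpace 𝕜 H]
    [CompleteSpace H] {K : ℕ → Type*} [∀ i, NormedAddCommGroup (K i)]
    [∀ i, InnerProductSpace 𝕜 (K i)] [∀ i, CompleteSpace (K i)] {Λ : ∀ i, H →L[𝕜] K i}
    (hΛ : IsGFrame Λ) (b : ∀ i, HilbertBasis ℕ 𝕜 (K i)) :
    IsFrame 𝕜 fun t : ℕ × ℕ => ContinuousLinearMap.adjoint (Λ t.1) (b t.1 t.2) := by
  obtain ⟨A, B, hA, hAB, h⟩ := hΛ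
  refine ⟨A, B, hA, hA.trans_le hAB, fun x => ?_⟩
  obtain ⟨hs, hl, hu⟩ := h x
  simp only [ContinuousLinearMap.adjoint_inner_left]
  have hP := fun i => hasSum_sq_norm_inner (b i) (Λ i x)
  have hsum : Summable fun t : ℕ × ℕ => ‖inner 𝕜 (b t.1 t.2) (Λ t.1 x)‖ ^ 2 := by
    refine (summable_prod_of_nonneg fun _ => by positivity).2 ⟨fun i => (hP i).summable, ?_⟩
    simpa only [(hP _).tsum_eq] using hs
  have htsum : ∑' t : ℕ × ℕ, ‖inner 𝕜 (b t.1 t.2) (Λ t.1 x)‖ ^ 2 = ∑' i, ‖Λ i x‖ ^ 2 := by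
    rw [hsum.tsum_prod]
    simp only [(hP _).tsum_eq]
  rw [htsum]
  exact ⟨hsum, hl, hu⟩

/-- The distance to `T† v` for a unit vector `v`, in terms of distances that do not involve the
adjoint. -/
theorem sq_dist_adjoint {H K : Type*} [NormedAddCommGroup H] [InnerProductSpace 𝕜 H]
    [CompleteSpace H] [NormedAddCommGroup K] [InnerProductSpace 𝕜 K] [CompleteSpace K]
    (T : H →L[𝕜] K) (x : H) {v : K} (hv : ‖v‖ = 1) :
    dist x (ContinuousLinearMap.adjoint T v) ^ 2 + (dist (T x) 0 ^ 2 + 1) =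
      dist x 0 ^ 2 + ‖ContinuousLinearMap.adjoint T v‖ ^ 2 + dist (T x) v ^ 2 := by
  rw [dist_eq_norm, dist_eq_norm (T x) v, dist_zero_right, dist_zero_right,
    @norm_sub_sq 𝕜, @norm_sub_sq 𝕜, ContinuousLinearMap.adjoint_inner_right, hv]
  ring

end Hilbert

end CompHilbert

/-! ### Computability of the frame of adjoint images -/

theorem theorem3p6 {𝕜 : Type*} [RCLike 𝕜]
    {H : Type*} [NormedAddCommGroup H] [InnerProductSpace 𝕜 H] [CompleteSpace H]
    {K : ℕ → Type*} [∀ i, NormedAddCommGroup (K i)] [∀ i, InnerProductSpace 𝕜 (K i)]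
    [∀ i, CompleteSpace (K i)]
    (e : ℕ → H) (he : CompHilbert.IsComputableHilbertSpace 𝕜 e)
    (u : ∀ i, ℕ → K i) (hu : CompHilbert.IsComputableHilbertFamily 𝕜 u)
    (b : ∀ i, HilbertBasis ℕ 𝕜 (K i))
    (hb : CompHilbert.ComputableFamily (fun t : ℕ × ℕ => CompHilbert.ratComb 𝕜 (u t.1))
      (fun t => b t.1 t.2))
    (Λ : ∀ i, H →L[𝕜] K i) (hΛ : CompHilbert.IsComputableGFrame e u Λ)
    (hnorm : CompHilbert.ComputableReals
      (fun t : ℕ × ℕ => ‖ContinuousLinearMap.adjoint (Λ t.1) (b t.1 t.2)‖)) :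
    CompHilbert.IsComputableFrame 𝕜 e
      (fun t : ℕ × ℕ => ContinuousLinearMap.adjoint (Λ t.1) (b t.1 t.2)) := by
  open CompHilbert in
  refine ⟨hΛ.1.isFrame_adjoint b, ?_⟩
  obtain ⟨z, hz⟩ := exists_ratComb_eq_zero (𝕜 := 𝕜)
  -- A second copy of the fact, for the universe of the spaces `K i`.
  obtain ⟨z', hz'⟩ := exists_ratComb_eq_zero (𝕜 := 𝕜)
  -- The index `((i, j), n)` stands for `Λ i`, the basis vector `b i j`, and the `n`-th rational
  -- combination of `e`, a candidate for an approximation.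
  have hfst : Computable fun s : (ℕ × ℕ) × ℕ => s.1.1 := Computable.fst.comp .fst
  have hval : ComputableFamily (fun s : (ℕ × ℕ) × ℕ => ratComb 𝕜 (u s.1.1))
      (fun s => Λ s.1.1 (ratComb 𝕜 e s.2)) :=
    hΛ.2.eval.comp (hfst.pair .snd)
  have ha : ComputableReals fun s : (ℕ × ℕ) × ℕ => dist (ratComb 𝕜 e s.2) 0 := by
    rw [← hz e]
    exact he.2.dist (φ := fun _ => ()) (.const ())
      (computableFamily_enum (fun _ => ratComb 𝕜 e) .snd)
      (computableFamily_enum (fun _ => ratComb 𝕜 e) (.const z))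
  have hd : ComputableReals fun s : (ℕ × ℕ) × ℕ => dist (Λ s.1.1 (ratComb 𝕜 e s.2)) 0 := by
    have h0 : (fun s : (ℕ × ℕ) × ℕ => dist (Λ s.1.1 (ratComb 𝕜 e s.2)) 0) =
        fun s => dist (Λ s.1.1 (ratComb 𝕜 e s.2)) (ratComb 𝕜 (u s.1.1) z') := by
      funext s
      rw [hz']
    rw [h0]
    exact hu.2.dist hfst hval (computableFamily_enum _ (.const z'))
  have hc : ComputableReals fun s : (ℕ × ℕ) × ℕ =>
      dist (Λ s.1.1 (ratComb 𝕜 e s.2)) (b s.1.1 s.1.2) :=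
    hu.2.dist hfst hval (hb.comp .fst)
  obtain ⟨g, hg, hgiff⟩ := ha.exists_semidecision (hnorm.comp Computable.fst) hc hd
    (fun _ => dist_nonneg) (fun _ => norm_nonneg _) (fun _ => dist_nonneg) (fun _ => dist_nonneg)
  have hgiff' : ∀ (t : ℕ × ℕ) (n k : ℕ), (∃ m, g ((t, n), k) m = true) ↔
      dist (ratComb 𝕜 e n) (ContinuousLinearMap.adjoint (Λ t.1) (b t.1 t.2)) <
        (1 / 2 : ℝ) ^ k := by
    intro t n k
    have h1 := sq_dist_adjoint (Λ t.1) (ratComb 𝕜 e n) ((b t.1).orthonormal.1 t.2)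
    have h4 : (1 / 4 : ℝ) ^ k = ((1 / 2 : ℝ) ^ k) ^ 2 := by
      rw [← pow_mul, mul_comm, pow_mul]; norm_num
    rw [hgiff, ← pow_lt_pow_iff_left₀ dist_nonneg (by positivity) two_ne_zero, ← h4]
    constructor <;> intro h <;> linarith
  -- Search for a pair `(n, m)` such that precision `m` confirms that the `n`-th combination is
  -- close enough; density guarantees that there is one.
  obtain ⟨f, hf, hfs⟩ := exists_computable_search
    (g := fun (s : (ℕ × ℕ) × ℕ) w => g ((s.1, w.unpair.1), s.2 + 1) w.unpair.2)
    (by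
      have hw : Computable fun p : ((ℕ × ℕ) × ℕ) × ℕ => p.2.unpair := Computable.unpair.comp .snd
      exact hg.comp
        (((Computable.fst.comp .fst).pair (Computable.fst.comp hw)).pair
          (Computable.succ.comp (Computable.snd.comp .fst)))
        (Computable.snd.comp hw))
    (fun s => by
      obtain ⟨n, hn⟩ := (he.2.1 ()).exists_dist_lt
        (ContinuousLinearMap.adjoint (Λ s.1.1) (b s.1.1 s.1.2))
        (by positivity : (0 : ℝ) < (1 / 2 : ℝ) ^ (s.2 + 1))
      rw [dist_comm] at hn
      obtain ⟨m, hm⟩ := (hgiff' s.1 n (s.2 + 1)).2 hn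
      exact ⟨Nat.pair n m, by simpa using hm⟩)
  refine ⟨fun t k => (f (t, k)).unpair.1, Computable.fst.comp (Computable.unpair.comp hf),
    fun t => IsCauchyName.of_dist_le fun k => ?_⟩
  exact ((hgiff' t _ (k + 1)).1 ⟨_, hfs (t, k)⟩).le
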